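/- Let $A=(A,\vee,\wedge,\odot,\rightarrow,0,1)$ be a (commutative, integral, bounded) residuated lattice, i.e. $(A,\vee,\wedge,0,1)$ is a bounded lattice, $(A,\odot,1)$ is a commutative monoid, and $a\le b\rightarrow c$ iff $a\odot b\le c$ for all $a,b,c\in A$. A filter of $A$ is a non-empty up-closed subset of $A$ that is closed under $\odot$. A filter $P\neq A$ is prime if $a\vee b\in P$ implies $a\in P$ or $b\in P$; a maximal filter is a maximal element, with respect to inclusion, of the set of the filters different from $A$; every maximal filter is prime. For $X\subseteq A$, $[X)$ denotes the smallest filter that includes $X$, and $[x)=[\{x\})$. The set $\mathrm{Filt}(A)$ of all filters is a bounded distributive lattice with meet $F\cap G$, join $F\vee G=[F\cup G)$, least element $\{1\}$ and greatest element $A$, and the set $\mathrm{PFilt}(A)=\{[x) : x\in A\}$ is a bounded sublattice of it. The set $\mathrm{Spec}(A)$ of the prime filters carries the Stone topology, whose open sets are the sets $\{P\in\mathrm{Spec}(A) : F\not\subseteq P\}$ with $F\in\mathrm{Filt}(A)$, and the set $\mathrm{Max}(A)\subseteq\mathrm{Spec}(A)$ of the maximal filters carries the subspace topology. For a bounded distributive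 lattice $L$, the same notions are defined with $\wedge$ in place of $\odot$. A bounded distributive lattice $L$ is normal if for all $x,y\in L$ with $x\vee y=1$ there are $u,v\in L$ with $u\wedge v=0$ and $u\vee x=v\vee y=1$; it is conormal if for all $x,y\in L$ with $x\wedge y=0$ there are $u,v\in L$ with $u\vee v=1$ and $u\wedge x=v\wedge y=0$. A topological space is normal if any two disjoint closed sets are included in disjoint open sets (no $T_1$ axiom is required). Let $(\mathcal L(A),\lambda)$ be a reticulation of $A$ (it exists and is unique up to isomorphism), i.e. $\mathcal L(A)$ is a bounded distributive lattice and $\lambda:A\to\mathcal L(A)$ is a surjection with $\lambda(a\odot b)=\lambda(a)\wedge\lambda(b)$, $\lambda(a\vee b)=\lambda(a)\vee\lambda(b)$, $\lambda(0)=0$, $\lambda(1)=1$, and $\lambda(a)\le\lambda(b)$ iff $a^n\le b$ for some integer $n\ge 1$. Then the following are equivalent: 1. the lattice $\mathrm{Filt}(A)$ is normal; 2. the lattice $\mathrm{PFilt}(A)$ is normal, that is: for all $x,y\in A$ with $[x)\vee[y)=A$ there are $u,v\in A$ with $[u)\cap[v)=\{1\}$ and $[u)\vee[x)=[v)\vee[y)=A$;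 3. the lattice $\mathcal L(A)$ is conormal; 4. every prime filter of $A$ is included in a unique maximal filter of $A$; 5. every prime filter of $\mathcal L(A)$ is included in a unique maximal filter of $\mathcal L(A)$; 6. there is a continuous map $r:\mathrm{Spec}(A)\to\mathrm{Max}(A)$ with $r(M)=M$ for all $M\in\mathrm{Max}(A)$; 7. there is a continuous map $r:\mathrm{Spec}(\mathcal L(A))\to\mathrm{Max}(\mathcal L(A))$ with $r(M)=M$ for all $M\in\mathrm{Max}(\mathcal L(A))$; 8. $\mathrm{Spec}(A)$ is a normal topological space; 9. $\mathrm{Spec}(\mathcal L(A))$ is a normal topological space; 10. for every $M\in\mathrm{Max}(A)$, the set $\{P\in\mathrm{Spec}(A) : P\subseteq M\}$ is closed in $\mathrm{Spec}(A)$; 11. for every $M\in\mathrm{Max}(\mathcal L(A))$, the set $\{P\in\mathrm{Spec}(\mathcal L(A)) : P\subseteq M\}$ is closed in $\mathrm{Spec}(\mathcal L(A))$; 12. for every $M\in\mathrm{Max}(A)$, $M$ is the only maximal filter of $A$ that includes $\bigcap\{P\in\mathrm{Spec}(A) : P\subseteq M\}$; 13. for every $M\in\mathrm{Max}(\mathcal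 L(A))$, $M$ is the only maximal filter of $\mathcal L(A)$ that includes $\bigcap\{P\in\mathrm{Spec}(\mathcal L(A)) : P\subseteq M\}$; 14. any two distinct maximal filters of $A$ have disjoint open neighbourhoods in $\mathrm{Spec}(A)$; 15. any two distinct maximal filters of $\mathcal L(A)$ have disjoint open neighbourhoods in $\mathrm{Spec}(\mathcal L(A))$. -/

import Mathlib

/-- Commutative integral bounded residuated lattices: a bounded lattice, a commutative monoid
whose unit is the greatest element, and the law of residuation.  Here `⊥`, `⊤ = 1` are the
constants `0`, `1`, the multiplication is `*`, and the residuum is `⇨`. -/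
class ResiduatedLattice (A : Type*) extends Lattice A, BoundedOrder A, CommMonoid A, HImp A where
  one_eq_top : (1 : A) = ⊤
  le_himp_iff_mul_le : ∀ a b c : A, a ≤ b ⇨ c ↔ a * b ≤ c

/-- A bounded lattice is normal if `x ⊔ y = ⊤` implies the existence of `u`, `v` with
`u ⊓ v = ⊥` and `u ⊔ x = v ⊔ y = ⊤`. -/
def IsNormalLattice (L : Type*) [Lattice L] [BoundedOrder L] : Prop :=
  ∀ x y : L, x ⊔ y = ⊤ → ∃ u v : L, u ⊓ v = ⊥ ∧ u ⊔ x = ⊤ ∧ v ⊔ y = ⊤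

/-- A bounded lattice is conormal if `x ⊓ y = ⊥` implies the existence of `u`, `v` with
`u ⊔ v = ⊤` and `u ⊓ x = v ⊓ y = ⊥`. -/
def IsConormalLattice (L : Type*) [Lattice L] [BoundedOrder L] : Prop :=
  ∀ x y : L, x ⊓ y = ⊥ → ∃ u v : L, u ⊔ v = ⊤ ∧ u ⊓ x = ⊥ ∧ v ⊓ y = ⊥

/-- Filters of a lattice with respect to a binary operation `op`: nonempty, closed under `op`,
upward closed.  The operation is the multiplication for a residuated lattice, and the meet for a
bounded distributive lattice. -/
structure OpFilter {X : Type*} [Lattice X] (op : X → X → X) where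
  carrier : Set X
  nonempty' : carrier.Nonempty
  op_mem' : ∀ {a b : X}, a ∈ carrier → b ∈ carrier → op a b ∈ carrier
  mem_of_le' : ∀ {a b : X}, a ∈ carrier → a ≤ b → b ∈ carrier

/-- The laws common to the multiplication of a residuated lattice and the meet of a bounded
distributive lattice. -/
class IsFilterOp {X : Type*} [Lattice X] [BoundedOrder X] (op : X → X → X) : Prop where
  comm : ∀ a b, op a b = op b a
  assoc : ∀ a b c, op (op a b) c = op a (op b c)
  op_top : ∀ a, op a ⊤ = a
  op_sup : ∀ a b c, op a (b ⊔ c) = op a b ⊔ op a c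

instance ResiduatedLattice.isFilterOp {A : Type*} [ResiduatedLattice A] :
    IsFilterOp (fun a b : A => a * b) where
  comm := mul_comm
  assoc := mul_assoc
  op_top a := by rw [← ResiduatedLattice.one_eq_top, mul_one]
  op_sup a b c := by
    have mono : ∀ x y : A, x ≤ y → x * a ≤ y * a := fun x y h =>
      (ResiduatedLattice.le_himp_iff_mul_le x a (y * a)).1
        (h.trans ((ResiduatedLattice.le_himp_iff_mul_le y a (y * a)).2 le_rfl))
    simp only [mul_comm a]
    apply le_antisymm
    · refine (ResiduatedLattice.le_himp_iff_mul_le _ _ _).1 (sup_le ?_ ?_)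
      · exact (ResiduatedLattice.le_himp_iff_mul_le _ _ _).2 le_sup_left
      · exact (ResiduatedLattice.le_himp_iff_mul_le _ _ _).2 le_sup_right
    · exact sup_le (mono _ _ le_sup_left) (mono _ _ le_sup_right)

instance DistribLattice.isFilterOp {L : Type*} [DistribLattice L] [BoundedOrder L] :
    IsFilterOp (fun a b : L => a ⊓ b) where
  comm := inf_comm
  assoc := inf_assoc
  op_top := inf_top_eq
  op_sup := inf_sup_left

namespace OpFilter

section Basic

variable {X : Type*} [Lattice X] {op : X → X → X}

instance : SetLike (OpFilter op) X where
  coe := carrier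
  coe_injective F G h := by cases F; cases G; congr

/-- Filters are ordered by inclusion. -/
instance : PartialOrder (OpFilter op) := PartialOrder.lift (SetLike.coe) SetLike.coe_injective

theorem le_iff {F G : OpFilter op} : F ≤ G ↔ ∀ a, a ∈ F → a ∈ G := Iff.rfl

theorem op_mem (F : OpFilter op) {a b : X} (ha : a ∈ F) (hb : b ∈ F) : op a b ∈ F :=
  F.op_mem' ha hb

theorem mem_of_le (F : OpFilter op) {a b : X} (ha : a ∈ F) (h : a ≤ b) : b ∈ F :=
  F.mem_of_le' ha h

theorem ext_mem {F G : OpFilter op} (h : ∀ a, a ∈ F ↔ a ∈ G) : F = G := SetLike.ext h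

/-- A proper filter is one that is not the whole lattice. -/
def IsProper (F : OpFilter op) : Prop := (F : Set X) ≠ Set.univ

/-- Prime filters. -/
def IsPrime (P : OpFilter op) : Prop :=
  P.IsProper ∧ ∀ a b : X, a ⊔ b ∈ P → a ∈ P ∨ b ∈ P

/-- Maximal filters: the maximal elements among the proper filters. -/
def IsMaximal (M : OpFilter op) : Prop := Maximal IsProper M

end Basic

section Lattice

variable {X : Type*} [Lattice X] [BoundedOrder X] {op : X → X → X}

theorem top_mem (F : OpFilter op) : ⊤ ∈ F :=
  let ⟨_, ha⟩ := F.nonempty'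
  F.mem_of_le ha le_top

/-- The filter `[S)` generated by `S`: the intersection of all filters that include `S`. -/
def generate (op : X → X → X) (S : Set X) : OpFilter op where
  carrier := ⋂ (F : OpFilter op) (_ : S ⊆ F), (F : Set X)
  nonempty' := ⟨⊤, Set.mem_iInter₂.2 fun F _ => F.top_mem⟩
  op_mem' ha hb := Set.mem_iInter₂.2 fun F hF =>
    F.op_mem (Set.mem_iInter₂.1 ha F hF) (Set.mem_iInter₂.1 hb F hF)
  mem_of_le' ha h := Set.mem_iInter₂.2 fun F hF => F.mem_of_le (Set.mem_iInter₂.1 ha F hF) h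

theorem mem_generate {S : Set X} {a : X} :
    a ∈ generate op S ↔ ∀ F : OpFilter op, S ⊆ F → a ∈ F := Set.mem_iInter₂

theorem subset_generate (S : Set X) : S ⊆ generate op S :=
  fun _ ha => mem_generate.2 fun _ hF => hF ha

theorem generate_le {S : Set X} {F : OpFilter op} : generate op S ≤ F ↔ S ⊆ F :=
  ⟨fun h _ ha => h (subset_generate S ha), fun h _ ha => mem_generate.1 ha F h⟩

/-- The principal filter `[x)`. -/
def principal (op : X → X → X) (x : X) : OpFilter op := generate op {x}

theorem principal_le {x : X} {F : OpFilter op} : principal op x ≤ F ↔ x ∈ F := by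
  simp [principal, generate_le]

theorem mem_principal_self (x : X) : x ∈ principal op x := principal_le.1 le_rfl

/-- The lattice structure on filters: meet is intersection, and `F ⊔ G = [F ∪ G)`. -/
instance : Lattice (OpFilter op) where
  toPartialOrder := inferInstance
  sup F G := generate op (F ∪ G)
  le_sup_left _ _ := Set.subset_union_left.trans (subset_generate _)
  le_sup_right _ _ := Set.subset_union_right.trans (subset_generate _)
  sup_le _ _ _ h₁ h₂ := generate_le.2 (Set.union_subset h₁ h₂)
  inf F G :=
    { carrier := F ∩ G
      nonempty' := ⟨⊤, F.top_mem, G.top_mem⟩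
      op_mem' := fun ha hb => ⟨F.op_mem ha.1 hb.1, G.op_mem ha.2 hb.2⟩
      mem_of_le' := fun ha h => ⟨F.mem_of_le ha.1 h, G.mem_of_le ha.2 h⟩ }
  inf_le_left _ _ := Set.inter_subset_left
  inf_le_right _ _ := Set.inter_subset_right
  le_inf _ _ _ h₁ h₂ := Set.subset_inter h₁ h₂

theorem mem_inf {F G : OpFilter op} {a : X} : a ∈ F ⊓ G ↔ a ∈ F ∧ a ∈ G := Iff.rfl

/-- The Stone topology on the set of prime filters, whose open sets are the sets
`D(F) = {P | F ⊈ P}`, for `F` an arbitrary filter. -/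
instance : TopologicalSpace {P : OpFilter op // P.IsPrime} where
  IsOpen U := ∃ F : OpFilter op, U = {P | ¬ F ≤ P.1}
  isOpen_univ := by
    refine ⟨⟨Set.univ, ⟨⊤, trivial⟩, fun _ _ => trivial, fun _ _ => trivial⟩, ?_⟩
    ext P
    simp only [Set.mem_univ, Set.mem_ofPred_eq, true_iff]
    exact fun h => P.2.1 (Set.eq_univ_of_univ_subset h)
  isOpen_inter := by
    rintro _ _ ⟨F, rfl⟩ ⟨G, rfl⟩
    refine ⟨F ⊓ G, ?_⟩
    ext P
    simp only [Set.mem_inter_iff, Set.mem_ofPred_eq]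
    refine ⟨fun ⟨hF, hG⟩ h => ?_, fun h => ⟨fun hF => h (inf_le_left.trans hF),
      fun hG => h (inf_le_right.trans hG)⟩⟩
    simp only [le_iff, not_forall] at hF hG
    obtain ⟨a, haF, haP⟩ := hF
    obtain ⟨b, hbG, hbP⟩ := hG
    have : a ⊔ b ∈ P.1 := h ⟨F.mem_of_le haF le_sup_left, G.mem_of_le hbG le_sup_right⟩
    exact (P.2.2 a b this).elim haP hbP
  isOpen_sUnion := by
    intro s hs
    refine ⟨generate op (⋃ (F : OpFilter op) (_ : {P : {P : OpFilter op // P.IsPrime} |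
      ¬ F ≤ P.1} ∈ s), (F : Set X)), ?_⟩
    ext P
    simp only [Set.mem_sUnion, Set.mem_ofPred_eq, generate_le, Set.iUnion₂_subset_iff, not_forall]
    constructor
    · rintro ⟨U, hU, hP⟩
      obtain ⟨F, rfl⟩ := hs U hU
      exact ⟨F, hU, hP⟩
    · rintro ⟨F, hF, hP⟩
      exact ⟨_, hF, hP⟩

variable [IsFilterOp op]

theorem op_le_op {a b c d : X} (h₁ : a ≤ b) (h₂ : c ≤ d) : op a c ≤ op b d := by
  have key : ∀ x y z : X, y ≤ z → op x y ≤ op x z := fun x y z h => by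
    rw [← sup_eq_right.2 h, IsFilterOp.op_sup (op := op)]
    exact le_sup_left
  refine (key a c d h₂).trans ?_
  rw [IsFilterOp.comm (op := op) a d, IsFilterOp.comm (op := op) b d]
  exact key d a b h₁

theorem op_le_left (a b : X) : op a b ≤ a := by
  have := op_le_op (op := op) (le_refl a) (le_top : b ≤ ⊤)
  rwa [IsFilterOp.op_top (op := op)] at this

theorem op_le_right (a b : X) : op a b ≤ b := by
  rw [IsFilterOp.comm (op := op)]
  exact op_le_left b a

theorem op_sup_sup_le (a b c : X) : op (a ⊔ c) (b ⊔ c) ≤ op a b ⊔ c := by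
  rw [IsFilterOp.op_sup (op := op), IsFilterOp.comm (op := op) (a ⊔ c) b,
    IsFilterOp.op_sup (op := op), IsFilterOp.comm (op := op) b a]
  exact sup_le (sup_le le_sup_left (le_sup_of_le_right (op_le_right b c)))
    (le_sup_of_le_right (op_le_right _ c))

theorem op_mem_iff {F : OpFilter op} {a b : X} : op a b ∈ F ↔ a ∈ F ∧ b ∈ F :=
  ⟨fun h => ⟨F.mem_of_le h (op_le_left a b), F.mem_of_le h (op_le_right a b)⟩,
    fun h => F.op_mem h.1 h.2⟩

theorem mem_sup {F G : OpFilter op} {a : X} :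
    a ∈ F ⊔ G ↔ ∃ x ∈ F, ∃ y ∈ G, op x y ≤ a := by
  constructor
  · intro h
    let H : OpFilter op :=
      { carrier := {a | ∃ x ∈ F, ∃ y ∈ G, op x y ≤ a}
        nonempty' := ⟨⊤, ⊤, F.top_mem, ⊤, G.top_mem, le_top⟩
        op_mem' := by
          rintro a b ⟨x, hx, y, hy, h⟩ ⟨x', hx', y', hy', h'⟩
          refine ⟨op x x', F.op_mem hx hx', op y y', G.op_mem hy hy', ?_⟩
          have e : op (op x x') (op y y') = op (op x y) (op x' y') := by
            rw [IsFilterOp.assoc (op := op), ← IsFilterOp.assoc (op := op) x' y y',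
              IsFilterOp.comm (op := op) x' y, IsFilterOp.assoc (op := op) y x' y',
              ← IsFilterOp.assoc (op := op) x y]
          rw [e]
          exact op_le_op h h'
        mem_of_le' := by
          rintro a b ⟨x, hx, y, hy, h⟩ hab
          exact ⟨x, hx, y, hy, h.trans hab⟩ }
    have hF : F ≤ H := fun x hx => ⟨x, hx, ⊤, G.top_mem, op_le_left x ⊤⟩
    have hG : G ≤ H := fun y hy => ⟨⊤, F.top_mem, y, hy, op_le_right ⊤ y⟩
    exact sup_le hF hG h
  · rintro ⟨x, hx, y, hy, h⟩
    exact mem_of_le _ (op_mem _ ((le_sup_left : F ≤ F ⊔ G) hx) ((le_sup_right : G ≤ F ⊔ G) hy)) h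

instance : DistribLattice (OpFilter op) :=
  DistribLattice.ofInfSupLe fun F G H a ha => by
    obtain ⟨haF, x, hx, y, hy, h⟩ := And.imp_right mem_sup.1 (mem_inf.1 ha)
    refine mem_sup.2 ⟨x ⊔ a, ⟨F.mem_of_le haF le_sup_right, G.mem_of_le hx le_sup_left⟩,
      y ⊔ a, ⟨F.mem_of_le haF le_sup_right, H.mem_of_le hy le_sup_left⟩, ?_⟩
    exact (op_sup_sup_le x y a).trans (sup_le h le_rfl)

/-- The least filter is the trivial filter `{⊤}`, the greatest one is the improper filter. -/
instance : BoundedOrder (OpFilter op) where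
  bot :=
    { carrier := {⊤}
      nonempty' := ⟨⊤, rfl⟩
      op_mem' := by
        rintro a b rfl rfl
        exact IsFilterOp.op_top ⊤
      mem_of_le' := by
        rintro a b rfl h
        exact top_le_iff.1 h }
  bot_le F a ha := by
    obtain rfl : a = ⊤ := ha
    exact F.top_mem
  top := ⟨Set.univ, ⟨⊤, trivial⟩, fun _ _ => trivial, fun _ _ => trivial⟩
  le_top _ _ _ := trivial

theorem mem_bot {a : X} : a ∈ (⊥ : OpFilter op) ↔ a = ⊤ := Iff.rfl

theorem mem_top (a : X) : a ∈ (⊤ : OpFilter op) := trivial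

theorem principal_sup_principal (a b : X) :
    principal op a ⊔ principal op b = principal op (op a b) := by
  refine eq_of_forall_ge_iff fun F => ?_
  simp only [sup_le_iff, principal_le, op_mem_iff]

theorem principal_inf_principal (a b : X) :
    principal op a ⊓ principal op b = principal op (a ⊔ b) := by
  apply le_antisymm
  · let Q : X → OpFilter op := fun y =>
      { carrier := {z | z ⊔ y ∈ principal op (a ⊔ b)}
        nonempty' := ⟨⊤, show ⊤ ⊔ y ∈ principal op (a ⊔ b) from
          mem_of_le _ (top_mem _) le_sup_left⟩
        op_mem' := fun {c d} h h' => show op c d ⊔ y ∈ principal op (a ⊔ b) from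
          mem_of_le _ (op_mem _ (show c ⊔ y ∈ principal op (a ⊔ b) from h)
            (show d ⊔ y ∈ principal op (a ⊔ b) from h')) (op_sup_sup_le (op := op) c d y)
        mem_of_le' := fun {c d} h h' => show d ⊔ y ∈ principal op (a ⊔ b) from
          mem_of_le _ (show c ⊔ y ∈ principal op (a ⊔ b) from h) (sup_le_sup_right h' y) }
    intro x hx
    have h₁ : principal op a ≤ Q b := principal_le.2 (mem_principal_self (a ⊔ b))
    have h₂ : x ⊔ b ∈ principal op (a ⊔ b) := h₁ hx.1
    have h₃ : principal op b ≤ Q x :=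
      principal_le.2 (show b ⊔ x ∈ principal op (a ⊔ b) by rwa [sup_comm b x])
    have h₄ : x ⊔ x ∈ principal op (a ⊔ b) := h₃ hx.2
    rwa [sup_idem] at h₄
  · exact principal_le.2 ⟨mem_of_le _ (mem_principal_self a) le_sup_left,
      mem_of_le _ (mem_principal_self b) le_sup_right⟩

theorem principal_bot : principal op (⊥ : X) = ⊤ :=
  top_unique fun _ _ => mem_of_le _ (mem_principal_self ⊥) bot_le

theorem principal_top : principal op (⊤ : X) = ⊥ := bot_unique (principal_le.2 (top_mem _))

/-- Every maximal filter is prime. -/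
theorem IsMaximal.isPrime {M : OpFilter op} (hM : M.IsMaximal) : M.IsPrime := by
  refine ⟨hM.1, fun a b hab => ?_⟩
  by_contra! h
  have key : ∀ c, c ∉ M → M ⊔ principal op c = ⊤ := by
    intro c hc
    by_contra hne
    have hp : (M ⊔ principal op c).IsProper := fun e => hne (SetLike.coe_injective e)
    exact hc (hM.2 hp le_sup_left (principal_le.1 le_sup_right))
  have : M ⊔ principal op (a ⊔ b) = ⊤ := by
    rw [← principal_inf_principal, sup_inf_left, key a h.1, key b h.2, inf_top_eq]
  rw [sup_eq_left.2 (principal_le.2 hab)] at this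
  exact hM.1 (by rw [this]; rfl)

/-- The principal filters form a sublattice of the lattice of all filters. -/
def principalSublattice (op : X → X → X) [IsFilterOp op] : Sublattice (OpFilter op) where
  carrier := Set.range (principal op)
  supClosed' := by
    rintro _ ⟨a, rfl⟩ _ ⟨b, rfl⟩
    exact ⟨op a b, (principal_sup_principal a b).symm⟩
  infClosed' := by
    rintro _ ⟨a, rfl⟩ _ ⟨b, rfl⟩
    exact ⟨a ⊔ b, (principal_inf_principal a b).symm⟩

/-- The sublattice of principal filters contains the trivial and the improper filter. -/
instance : BoundedOrder (principalSublattice op) where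
  top := ⟨⊤, ⊥, principal_bot⟩
  le_top F := (le_top : F.1 ≤ ⊤)
  bot := ⟨⊥, ⊤, principal_top⟩
  bot_le F := (bot_le : ⊥ ≤ F.1)

end Lattice

end OpFilter

/-- The prime spectrum, with the Stone topology. -/
abbrev PrimeSpec {X : Type*} [Lattice X] (op : X → X → X) : Type _ :=
  {P : OpFilter op // P.IsPrime}

/-- The maximal spectrum. -/
def MaxSpec {X : Type*} [Lattice X] (op : X → X → X) : Type _ := {M : OpFilter op // M.IsMaximal}

/-- The inclusion of the maximal spectrum into the prime spectrum. -/
def MaxSpec.incl {X : Type*} [Lattice X] [BoundedOrder X] {op : X → X → X} [IsFilterOp op]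
    (M : MaxSpec op) : PrimeSpec op := ⟨M.1, M.2.isPrime⟩

/-- The Stone topology of the maximal spectrum is induced by that of the prime spectrum. -/
instance {X : Type*} [Lattice X] [BoundedOrder X] {op : X → X → X} [IsFilterOp op] :
    TopologicalSpace (MaxSpec op) := TopologicalSpace.induced MaxSpec.incl inferInstance

section Residuated

variable (A : Type*) [ResiduatedLattice A]

/-- `Filt(A)`, for a residuated lattice `A`. -/
abbrev Filt : Type _ := OpFilter (fun a b : A => a * b)

/-- `PFilt(A)`, the bounded sublattice of `Filt(A)` of the principal filters. -/
abbrev PFilt : Type _ := OpFilter.principalSublattice (fun a b : A => a * b)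

/-- `Spec(A)`, for a residuated lattice `A`. -/
abbrev ResSpec : Type _ := PrimeSpec (fun a b : A => a * b)

/-- `Max(A)`, for a residuated lattice `A`. -/
abbrev ResMax : Type _ := MaxSpec (fun a b : A => a * b)

end Residuated

section Distributive

variable (L : Type*) [DistribLattice L] [BoundedOrder L]

/-- `Filt(L)`, for a bounded distributive lattice `L`. -/
abbrev LatFilt : Type _ := OpFilter (fun a b : L => a ⊓ b)

/-- `Spec(L)`, for a bounded distributive lattice `L`. -/
abbrev LatSpec : Type _ := PrimeSpec (fun a b : L => a ⊓ b)

/-- `Max(L)`, for a bounded distributive lattice `L`. -/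
abbrev LatMax : Type _ := MaxSpec (fun a b : L => a ⊓ b)

end Distributive

/-- `(L, lam)` is a reticulation of the residuated lattice `A`. -/
structure IsReticulation {A L : Type*} [ResiduatedLattice A] [DistribLattice L] [BoundedOrder L]
    (lam : A → L) : Prop where
  map_mul : ∀ a b, lam (a * b) = lam a ⊓ lam b
  map_sup : ∀ a b, lam (a ⊔ b) = lam a ⊔ lam b
  map_bot : lam ⊥ = ⊥
  map_top : lam ⊤ = ⊤
  surjective : Function.Surjective lam
  le_iff : ∀ a b, lam a ≤ lam b ↔ ∃ n : ℕ, 0 < n ∧ a ^ n ≤ b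

theorem ResiduatedLattice.mem_principal_iff {A : Type*} [ResiduatedLattice A] {a b : A} :
    b ∈ OpFilter.principal (fun a b : A => a * b) a ↔ ∃ n : ℕ, 0 < n ∧ a ^ n ≤ b := by
  constructor
  · intro h
    let H : Filt A :=
      { carrier := {b | ∃ n : ℕ, 0 < n ∧ a ^ n ≤ b}
        nonempty' := ⟨a, 1, one_pos, (pow_one a).le⟩
        op_mem' := by
          rintro x y ⟨n, hn, hx⟩ ⟨m, hm, hy⟩
          refine ⟨n + m, Nat.add_pos_left hn m, ?_⟩
          rw [pow_add]
          exact OpFilter.op_le_op (op := fun a b : A => a * b) hx hy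
        mem_of_le' := by
          rintro x y ⟨n, hn, hx⟩ h
          exact ⟨n, hn, hx.trans h⟩ }
    have : OpFilter.principal (fun a b : A => a * b) a ≤ H :=
      OpFilter.principal_le.2 ⟨1, one_pos, (pow_one a).le⟩
    exact this h
  · rintro ⟨n, -, h⟩
    refine OpFilter.mem_of_le _ ?_ h
    clear h
    induction n with
    | zero =>
      rw [pow_zero, ResiduatedLattice.one_eq_top]
      exact OpFilter.top_mem _
    | succ k ih =>
      rw [pow_succ]
      exact OpFilter.op_mem _ ih (OpFilter.mem_principal_self a)

/-- Every residuated lattice has a reticulation: the dual of the lattice of principal filters. -/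
theorem ResiduatedLattice.isReticulation_principal (A : Type*) [ResiduatedLattice A] :
    IsReticulation (fun a : A => OrderDual.toDual
      (⟨OpFilter.principal (fun a b : A => a * b) a, a, rfl⟩ : PFilt A)) where
  map_mul a b := congrArg OrderDual.toDual
    (Subtype.ext (OpFilter.principal_sup_principal a b).symm)
  map_sup a b := congrArg OrderDual.toDual
    (Subtype.ext (OpFilter.principal_inf_principal a b).symm)
  map_bot := congrArg OrderDual.toDual (Subtype.ext OpFilter.principal_bot)
  map_top := congrArg OrderDual.toDual (Subtype.ext OpFilter.principal_top)
  surjective := by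
    rintro ⟨_, a, rfl⟩
    exact ⟨a, rfl⟩
  le_iff a b := by
    rw [← ResiduatedLattice.mem_principal_iff, ← OpFilter.principal_le]
    rfl

/-! The conditions on prime filters and spectra come in pairs, one for `A` and one for `L`, and both
are instances of a statement about filters with respect to an operation that distributes over joins.
So `isNormalLattice_tfae` proves them equivalent once, for any such operation. Its core is normality
in terms of elements: if `[x)` and `[y)` generate everything, there are `u ⊔ v = ⊤` with `u` coprime
to `x` and `v` to `y`. Every prime filter contains `u` or `v`, so the primes omitting `u` and those
omitting `v` form disjoint open sets; this yields separation, the retraction and closedness.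
Conversely, each condition forces a unique maximal filter above each prime, and
`isNormalLattice_of_existsUnique` recovers normality by the prime filter theorem. The two instances
are linked without comparing spectra: `[a) ⊔ [b) = ⊤` iff `lam a ⊓ lam b = ⊥`, so `PFilt A` is
normal iff `L` is conormal, which is normality of the principal filters of `L`. -/

namespace OpFilter

/-! ### Maximal filters and closed sets of the spectrum. -/

section Generic

variable {X : Type*} [Lattice X] {op : X → X → X}

theorem IsMaximal.eq_of_le {M N : OpFilter op} (hM : M.IsMaximal) (hN : N.IsMaximal)
    (h : M ≤ N) : M = N :=
  le_antisymm h (hM.2 hN.1 h)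

variable [BoundedOrder X]

theorem isProper_iff {F : OpFilter op} : F.IsProper ↔ ⊥ ∉ F := by
  refine not_congr ⟨fun h => ?_, fun h => ?_⟩
  · rw [← SetLike.mem_coe, h]
    trivial
  · exact Set.eq_univ_of_forall fun _ => F.mem_of_le h bot_le

/-- The union of a nonempty chain of filters is a filter. -/
def chainUnion (c : Set (OpFilter op)) (hc : IsChain (· ≤ ·) c) (hne : c.Nonempty) :
    OpFilter op where
  carrier := {a | ∃ F ∈ c, a ∈ F}
  nonempty' := let ⟨F, hF⟩ := hne; ⟨⊤, F, hF, F.top_mem⟩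
  op_mem' := by
    rintro a b ⟨F, hF, ha⟩ ⟨G, hG, hb⟩
    rcases hc.total hF hG with h | h
    · exact ⟨G, hG, G.op_mem (h ha) hb⟩
    · exact ⟨F, hF, F.op_mem ha (h hb)⟩
  mem_of_le' := by
    rintro a b ⟨F, hF, ha⟩ h
    exact ⟨F, hF, F.mem_of_le ha h⟩

/-- A filter disjoint from a set is included in a filter maximal with this property. -/
theorem exists_le_maximal_disjoint (F : OpFilter op) (I : Set X) (h : ∀ a ∈ I, a ∉ F) :
    ∃ M, F ≤ M ∧ Maximal (fun G : OpFilter op => ∀ a ∈ I, a ∉ G) M := by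
  refine zorn_le_nonempty₀ {G : OpFilter op | ∀ a ∈ I, a ∉ G} ?_ F h
  intro c hcs hc G hG
  refine ⟨chainUnion c hc ⟨G, hG⟩, ?_, fun H hH a ha => ⟨H, hH, ha⟩⟩
  rintro a ha ⟨H, hH, haH⟩
  exact hcs hH a ha haH

theorem exists_le_isMaximal {F : OpFilter op} (hF : F.IsProper) :
    ∃ M : OpFilter op, M.IsMaximal ∧ F ≤ M := by
  obtain ⟨M, hFM, hM⟩ := exists_le_maximal_disjoint F {⊥} (by simpa [isProper_iff] using hF)
  refine ⟨M, ⟨isProper_iff.2 (hM.1 ⊥ rfl), fun G hG hMG => hM.2 ?_ hMG⟩, hFM⟩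
  simpa [isProper_iff] using hG

theorem isClosed_iff {s : Set (PrimeSpec op)} :
    IsClosed s ↔ ∃ F : OpFilter op, s = {P | F ≤ P.1} := by
  rw [← isOpen_compl_iff]
  refine exists_congr fun F => ?_
  rw [compl_eq_comm, eq_comm]
  simp [Set.compl_def]

theorem isOpen_setOf_notMem (a : X) : IsOpen {P : PrimeSpec op | a ∉ P.1} :=
  ⟨principal op a, by simp only [principal_le]⟩

theorem existsUnique_of_unique (h : ∀ P : OpFilter op, P.IsPrime → ∀ M N : OpFilter op,
      M.IsMaximal → N.IsMaximal → P ≤ M → P ≤ N → M = N) (P : OpFilter op) (hP : P.IsPrime) :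
    ∃! M : OpFilter op, M.IsMaximal ∧ P ≤ M := by
  obtain ⟨M, hM, hPM⟩ := exists_le_isMaximal hP.1
  exact ⟨M, ⟨hM, hPM⟩, fun N hN => h P hP N M hN.1 hM hN.2 hPM⟩

theorem existsUnique_isMaximal_of_iInter
    (h : ∀ M : OpFilter op, M.IsMaximal → ∀ N : OpFilter op, N.IsMaximal →
      ((⋂ P ∈ {P : OpFilter op | P.IsPrime ∧ P ≤ M}, (P : Set X)) ⊆ (N : Set X) ↔ N = M)) :
    ∀ P : OpFilter op, P.IsPrime → ∃! M : OpFilter op, M.IsMaximal ∧ P ≤ M :=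
  existsUnique_of_unique fun P hP M N hM hN hPM hPN => ((h M hM N hN).1
    ((Set.biInter_subset_of_mem (show P ∈ {P : OpFilter op | P.IsPrime ∧ P ≤ M} from
      ⟨hP, hPM⟩)).trans hPN)).symm

/-! ### Coprime filters and the prime filter theorem. -/

variable [IsFilterOp op]

theorem eq_top_iff_bot_mem {F : OpFilter op} : F = ⊤ ↔ ⊥ ∈ F :=
  ⟨fun h => h ▸ mem_top _, fun h => top_unique fun _ _ => F.mem_of_le h bot_le⟩

theorem IsProper.ne_top {F : OpFilter op} (hF : F.IsProper) : F ≠ ⊤ :=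
  fun h => isProper_iff.1 hF (eq_top_iff_bot_mem.1 h)

/-- A compactness property: membership of `⊥` in a join is witnessed by one element from each side.
It reduces coprimality of filters to that of elements. -/
theorem sup_eq_top_iff {F G : OpFilter op} :
    F ⊔ G = ⊤ ↔ ∃ x ∈ F, ∃ y ∈ G, principal op x ⊔ principal op y = ⊤ := by
  constructor
  · intro h
    obtain ⟨x, hx, y, hy, hxy⟩ := mem_sup.1 (eq_top_iff_bot_mem.1 h)
    refine ⟨x, hx, y, hy, ?_⟩
    rw [principal_sup_principal, le_bot_iff.1 hxy, principal_bot]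
  · rintro ⟨x, hx, y, hy, h⟩
    exact top_unique (h ▸ sup_le_sup (principal_le.2 hx) (principal_le.2 hy))

theorem principal_eq_bot_iff {a : X} : principal op a = ⊥ ↔ a = ⊤ := by
  rw [← le_bot_iff, principal_le, mem_bot]

theorem IsProper.notMem_of_sup_eq_top {F : OpFilter op} (hF : F.IsProper) {u x : X}
    (h : principal op u ⊔ principal op x = ⊤) (hx : x ∈ F) : u ∉ F := fun hu =>
  hF.ne_top (top_unique (h ▸ sup_le (principal_le.2 hu) (principal_le.2 hx)))

theorem IsMaximal.sup_eq_top {M F : OpFilter op} (hM : M.IsMaximal) (h : ¬ F ≤ M) :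
    F ⊔ M = ⊤ := by
  by_contra hne
  have hp : (F ⊔ M).IsProper := fun e => hne (SetLike.coe_injective e)
  exact h (le_sup_left.trans (hM.2 hp le_sup_right))

/-- The prime filter theorem: a filter that does not meet an ideal can be extended to a prime
filter that does not meet it. -/
theorem exists_isPrime_disjoint (F : OpFilter op) (I : Order.Ideal X) (h : ∀ a ∈ I, a ∉ F) :
    ∃ P : OpFilter op, P.IsPrime ∧ F ≤ P ∧ ∀ a ∈ I, a ∉ P := by
  obtain ⟨P, hFP, hP⟩ := exists_le_maximal_disjoint F (I : Set X) h
  refine ⟨P, ⟨isProper_iff.2 (hP.1 ⊥ I.bot_mem), fun a b hab => ?_⟩, hFP, hP.1⟩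
  by_contra! hn
  have key : ∀ c, c ∉ P → ∃ i ∈ I, i ∈ P ⊔ principal op c := by
    intro c hc
    by_contra! hi
    exact hc (hP.2 hi le_sup_left (principal_le.1 le_sup_right))
  obtain ⟨i, hi, hia⟩ := key a hn.1
  obtain ⟨j, hj, hjb⟩ := key b hn.2
  refine hP.1 (i ⊔ j) (I.sup_mem hi hj) ?_
  -- By distributivity of the filter lattice this meet is `P ⊔ [a ⊔ b) = P`.
  have h₁ : i ⊔ j ∈ (P ⊔ principal op a) ⊓ (P ⊔ principal op b) :=
    ⟨mem_of_le _ hia le_sup_left, mem_of_le _ hjb le_sup_right⟩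
  rwa [← sup_inf_left, principal_inf_principal, sup_eq_left.2 (principal_le.2 hab)] at h₁

variable (op) in
/-- The ideal of the elements `u` such that `[u)` and `[x)` generate the improper filter. -/
def coprimeIdeal (x : X) : Order.Ideal X where
  carrier := {u | principal op u ⊔ principal op x = ⊤}
  lower' a b hba ha := by
    refine top_unique ((ge_of_eq ha).trans (sup_le_sup_right ?_ _))
    exact principal_le.2 (mem_of_le _ (mem_principal_self b) hba)
  nonempty' := ⟨⊥, by simp [principal_bot]⟩
  directed' a ha b hb := by
    refine ⟨a ⊔ b, ?_, le_sup_left, le_sup_right⟩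
    change principal op (a ⊔ b) ⊔ principal op x = ⊤
    rw [← principal_inf_principal, sup_inf_right]
    exact inf_eq_top_iff.2 ⟨ha, hb⟩

/-! ### Normality, separation of maximal filters, and uniqueness of the maximal filter above a
prime. -/

theorem isNormalLattice_principalSublattice_iff :
    IsNormalLattice (principalSublattice op) ↔
      ∀ x y : X, principal op x ⊔ principal op y = ⊤ → ∃ u v : X, u ⊔ v = ⊤ ∧
        principal op u ⊔ principal op x = ⊤ ∧ principal op v ⊔ principal op y = ⊤ := by
  constructor
  · intro h x y hxy
    obtain ⟨⟨_, u, rfl⟩, ⟨_, v, rfl⟩, huv, hu, hv⟩ :=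
      h ⟨_, x, rfl⟩ ⟨_, y, rfl⟩ (Subtype.ext hxy)
    refine ⟨u, v, ?_, congrArg Subtype.val hu, congrArg Subtype.val hv⟩
    rw [← principal_eq_bot_iff (op := op), ← principal_inf_principal]
    exact congrArg Subtype.val huv
  · rintro h ⟨_, x, rfl⟩ ⟨_, y, rfl⟩ hxy
    obtain ⟨u, v, huv, hu, hv⟩ := h x y (congrArg Subtype.val hxy)
    refine ⟨⟨_, u, rfl⟩, ⟨_, v, rfl⟩, Subtype.ext ?_, Subtype.ext hu, Subtype.ext hv⟩
    change principal op u ⊓ principal op v = ⊥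
    rw [principal_inf_principal, huv, principal_top]

theorem isNormalLattice_iff_principalSublattice :
    IsNormalLattice (OpFilter op) ↔ IsNormalLattice (principalSublattice op) := by
  rw [isNormalLattice_principalSublattice_iff]
  constructor
  · intro h x y hxy
    obtain ⟨F, G, hFG, hF, hG⟩ := h _ _ hxy
    obtain ⟨u, hu, x', hx', hux⟩ := sup_eq_top_iff.1 hF
    obtain ⟨v, hv, y', hy', hvy⟩ := sup_eq_top_iff.1 hG
    refine ⟨u, v, ?_, sup_eq_top_iff.2 ⟨u, mem_principal_self u, x', hx', hux⟩,
      sup_eq_top_iff.2 ⟨v, mem_principal_self v, y', hy', hvy⟩⟩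
    -- `u ⊔ v` lies in both `F` and `G`, whose intersection is `{⊤}`.
    rw [← mem_bot (op := op), ← hFG]
    exact ⟨F.mem_of_le hu le_sup_left, G.mem_of_le hv le_sup_right⟩
  · intro h F G hFG
    obtain ⟨x, hx, y, hy, hxy⟩ := sup_eq_top_iff.1 hFG
    obtain ⟨u, v, huv, hu, hv⟩ := h x y hxy
    refine ⟨principal op u, principal op v, ?_,
      sup_eq_top_iff.2 ⟨u, mem_principal_self u, x, hx, hu⟩,
      sup_eq_top_iff.2 ⟨v, mem_principal_self v, y, hy, hv⟩⟩
    rw [principal_inf_principal, huv, principal_top]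

theorem separated_of_isNormalLattice (h : IsNormalLattice (principalSublattice op))
    (M N : MaxSpec op) (hMN : M ≠ N) : ∃ U V : Set (PrimeSpec op),
      IsOpen U ∧ IsOpen V ∧ M.incl ∈ U ∧ N.incl ∈ V ∧ Disjoint U V := by
  have hle : ¬ M.1 ≤ N.1 := fun hle => hMN (Subtype.ext (M.2.eq_of_le N.2 hle))
  obtain ⟨x, hx, y, hy, hxy⟩ := sup_eq_top_iff.1 (N.2.sup_eq_top hle)
  obtain ⟨u, v, huv, hu, hv⟩ := isNormalLattice_principalSublattice_iff.1 h x y hxy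
  refine ⟨_, _, isOpen_setOf_notMem u, isOpen_setOf_notMem v, M.2.1.notMem_of_sup_eq_top hu hx,
    N.2.1.notMem_of_sup_eq_top hv hy, Set.disjoint_left.2 fun P hP hP' => ?_⟩
  exact (P.2.2 u v (huv ▸ P.1.top_mem)).elim hP hP'

/-- Open sets are closed under passing to smaller primes, so a prime below both `M` and `N` would
lie in both of their neighbourhoods. -/
theorem existsUnique_isMaximal_of_separated
    (h : ∀ M N : MaxSpec op, M ≠ N → ∃ U V : Set (PrimeSpec op),
      IsOpen U ∧ IsOpen V ∧ M.incl ∈ U ∧ N.incl ∈ V ∧ Disjoint U V) :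
    ∀ P : OpFilter op, P.IsPrime → ∃! M : OpFilter op, M.IsMaximal ∧ P ≤ M := by
  refine existsUnique_of_unique fun P hP M N hM hN hPM hPN => ?_
  by_contra hne
  obtain ⟨_, _, ⟨F, rfl⟩, ⟨G, rfl⟩, hMF, hNG, hd⟩ :=
    h ⟨M, hM⟩ ⟨N, hN⟩ fun e => hne (congrArg Subtype.val e)
  exact Set.disjoint_left.1 hd (show (⟨P, hP⟩ : PrimeSpec op) ∈ _ from fun hF => hMF (hF.trans hPM))
    (fun hG => hNG (hG.trans hPN))

theorem isNormalLattice_of_existsUnique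
    (h : ∀ P : OpFilter op, P.IsPrime → ∃! M : OpFilter op, M.IsMaximal ∧ P ≤ M) :
    IsNormalLattice (principalSublattice op) := by
  refine isNormalLattice_principalSublattice_iff.2 fun x y hxy => ?_
  by_contra! hn
  -- The join of the ideals of elements coprime to `x` and to `y`, closed downwards by hand since
  -- `X` need not be distributive. Failure of normality at `x`, `y` says exactly that `⊤ ∉ I`.
  let I : Order.Ideal X :=
    { carrier := {a | ∃ u ∈ coprimeIdeal op x, ∃ v ∈ coprimeIdeal op y, a ≤ u ⊔ v}
      lower' := by
        rintro a b hba ⟨u, hu, v, hv, ha⟩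
        exact ⟨u, hu, v, hv, hba.trans ha⟩
      nonempty' := ⟨⊥, ⊥, Order.Ideal.bot_mem _, ⊥, Order.Ideal.bot_mem _, bot_le⟩
      directed' := by
        rintro a ⟨u, hu, v, hv, ha⟩ b ⟨u', hu', v', hv', hb⟩
        refine ⟨a ⊔ b, ⟨u ⊔ u', Order.Ideal.sup_mem hu hu', v ⊔ v',
          Order.Ideal.sup_mem hv hv', ?_⟩, le_sup_left, le_sup_right⟩
        rw [sup_sup_sup_comm]
        exact sup_le_sup ha hb }
  obtain ⟨P, hP, -, hPI⟩ := exists_isPrime_disjoint (⊥ : OpFilter op) I (by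
    rintro a ⟨u, hu, v, hv, ha⟩ rfl
    exact hn u v (top_unique ha) hu hv)
  -- A filter without elements coprime to `z` stays proper when `z` is adjoined. For `z = x` and `z
  -- = y` this gives maximal filters above `P`, which must coincide although `x` and `y` are
  -- coprime.
  have key : ∀ z, (∀ u ∈ coprimeIdeal op z, u ∉ P) →
      ∃ M : OpFilter op, M.IsMaximal ∧ P ≤ M ∧ z ∈ M := by
    intro z hz
    have hp : (P ⊔ principal op z).IsProper := by
      intro e
      obtain ⟨u, hu, z', hz', hh⟩ := sup_eq_top_iff.1 (SetLike.coe_injective e)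
      exact hz u (sup_eq_top_iff.2 ⟨u, mem_principal_self u, z', hz', hh⟩) hu
    obtain ⟨M, hM, hle⟩ := exists_le_isMaximal hp
    exact ⟨M, hM, le_sup_left.trans hle, principal_le.1 (le_sup_right.trans hle)⟩
  obtain ⟨M, hM, hPM, hxM⟩ := key x fun u hu =>
    hPI u ⟨u, hu, ⊥, Order.Ideal.bot_mem _, le_sup_left⟩
  obtain ⟨N, hN, hPN, hyN⟩ := key y fun v hv =>
    hPI v ⟨⊥, Order.Ideal.bot_mem _, v, hv, le_sup_right⟩
  obtain rfl := (h P hP).unique ⟨hM, hPM⟩ ⟨hN, hPN⟩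
  exact hM.1.notMem_of_sup_eq_top hxy hyN hxM

/-! ### Normal spectra, retractions and closed sets of primes below a maximal filter. -/

theorem normalSpace_of_isNormalLattice (h : IsNormalLattice (OpFilter op)) :
    NormalSpace (PrimeSpec op) where
  normal s t hs ht hst := by
    obtain ⟨F, rfl⟩ := isClosed_iff.1 hs
    obtain ⟨G, rfl⟩ := isClosed_iff.1 ht
    -- Otherwise a maximal filter above `F ⊔ G`, being prime, would lie in both closed sets.
    have hFG : F ⊔ G = ⊤ := by
      by_contra hne
      have hp : (F ⊔ G).IsProper := fun e => hne (SetLike.coe_injective e)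
      obtain ⟨M, hM, hle⟩ := exists_le_isMaximal hp
      exact Set.disjoint_left.1 hst
        (show (⟨M, hM.isPrime⟩ : PrimeSpec op) ∈ _ from le_sup_left.trans hle) (le_sup_right.trans hle)
    obtain ⟨U, V, hUV, hU, hV⟩ := h F G hFG
    refine ⟨_, _, ⟨U, rfl⟩, ⟨V, rfl⟩, fun P hP hUP => ?_, fun P hP hVP => ?_, ?_⟩
    · exact P.2.1.ne_top (top_unique (hU ▸ sup_le hUP hP))
    · exact P.2.1.ne_top (top_unique (hV ▸ sup_le hVP hP))
    · refine Set.disjoint_left.2 fun P hUP hVP => ?_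
      simp only [Set.mem_ofPred_eq, le_iff, not_forall] at hUP hVP
      obtain ⟨u, hu, huP⟩ := hUP
      obtain ⟨v, hv, hvP⟩ := hVP
      have huv : u ⊔ v = ⊤ := by
        rw [← mem_bot (op := op), ← hUV]
        exact ⟨U.mem_of_le hu le_sup_left, V.mem_of_le hv le_sup_right⟩
      exact (P.2.2 u v (huv ▸ P.1.top_mem)).elim huP hvP

/-- By maximality the closed set of primes above `M` is the singleton of `M`. -/
theorem separated_of_normalSpace (h : NormalSpace (PrimeSpec op))
    (M N : MaxSpec op) (hMN : M ≠ N) : ∃ U V : Set (PrimeSpec op),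
      IsOpen U ∧ IsOpen V ∧ M.incl ∈ U ∧ N.incl ∈ V ∧ Disjoint U V := by
  obtain ⟨U, V, hU, hV, hMU, hNV, hd⟩ := h.normal _ _ (isClosed_iff.2 ⟨M.1, rfl⟩)
    (isClosed_iff.2 ⟨N.1, rfl⟩) (Set.disjoint_left.2 fun P hM hN => hMN (Subtype.ext
      ((le_antisymm hM (M.2.2 P.2.1 hM)).trans (le_antisymm hN (N.2.2 P.2.1 hN)).symm)))
  exact ⟨U, V, hU, hV, hMU (le_refl M.1), hNV (le_refl N.1), hd⟩

theorem exists_retraction (h : IsNormalLattice (principalSublattice op))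
    (h' : ∀ P : OpFilter op, P.IsPrime → ∃! M : OpFilter op, M.IsMaximal ∧ P ≤ M) :
    ∃ r : PrimeSpec op → MaxSpec op, Continuous r ∧ ∀ M : MaxSpec op, r M.incl = M := by
  choose r hr hr' using fun P : PrimeSpec op => h' P.1 P.2
  refine ⟨fun P => ⟨r P, (hr P).1⟩, ?_, fun M =>
    Subtype.ext (hr' M.incl M.1 ⟨M.2, le_rfl⟩).symm⟩
  refine continuous_induced_rng.2 (continuous_def.2 ?_)
  rintro _ ⟨F, rfl⟩
  refine isOpen_iff_forall_mem_open.2 fun P hP => ?_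
  obtain ⟨f, hf, m, hm, hfm⟩ := sup_eq_top_iff.1 ((hr P).1.sup_eq_top hP)
  obtain ⟨u, v, huv, hu, hv⟩ := isNormalLattice_principalSublattice_iff.1 h f m hfm
  -- The neighbourhood of `P` consists of the primes omitting `v`: they contain `u`, which is
  -- coprime to `f`, so `f` is not in their image under `r`.
  refine ⟨_, fun Q hvQ hF => ?_, isOpen_setOf_notMem v, fun hvP =>
    (hr P).1.1.notMem_of_sup_eq_top hv hm ((hr P).2 hvP)⟩
  have huQ : u ∈ Q.1 := (Q.2.2 u v (huv ▸ Q.1.top_mem)).resolve_right hvQ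
  exact (hr Q).1.1.notMem_of_sup_eq_top hu (hF hf) ((hr Q).2 huQ)

theorem existsUnique_isMaximal_of_retraction
    (h : ∃ r : PrimeSpec op → MaxSpec op, Continuous r ∧ ∀ M : MaxSpec op, r M.incl = M) :
    ∀ P : OpFilter op, P.IsPrime → ∃! M : OpFilter op, M.IsMaximal ∧ P ≤ M := by
  obtain ⟨r, hr, hrM⟩ := h
  have key : ∀ (P : PrimeSpec op) (M : MaxSpec op), P.1 ≤ M.1 → r P = M := by
    intro P M hPM
    -- The preimage of the closed set of primes above `r P` contains `P`, hence every larger prime,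
    -- in particular `M`; thus `r P ≤ r M = M`.
    obtain ⟨F, hF⟩ := isClosed_iff.1 ((isClosed_iff.2 ⟨(r P).1, rfl⟩).preimage
      ((continuous_induced_dom (f := MaxSpec.incl)).comp hr))
    have hP : F ≤ P.1 := (Set.ext_iff.1 hF P).1 (le_refl (r P).1)
    have hM : (r P).1 ≤ (r M.incl).1 := (Set.ext_iff.1 hF M.incl).2 (hP.trans hPM)
    rw [hrM] at hM
    exact Subtype.ext ((r P).2.eq_of_le M.2 hM)
  exact existsUnique_of_unique fun P hP M N hM hN hPM hPN => congrArg Subtype.val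
    ((key ⟨P, hP⟩ ⟨M, hM⟩ hPM).symm.trans (key ⟨P, hP⟩ ⟨N, hN⟩ hPN))

theorem isClosed_setOf_le (h : IsNormalLattice (principalSublattice op))
    (M : OpFilter op) (hM : M.IsMaximal) : IsClosed {P : PrimeSpec op | P.1 ≤ M} := by
  refine isOpen_compl_iff.1 (isOpen_iff_forall_mem_open.2 fun P hP => ?_)
  obtain ⟨p, hp, m, hm, hpm⟩ := sup_eq_top_iff.1 (hM.sup_eq_top hP)
  obtain ⟨u, v, huv, hu, hv⟩ := isNormalLattice_principalSublattice_iff.1 h p m hpm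
  -- A prime omitting `u` contains `v`, which is coprime to `m ∈ M`, so it is not below `M`.
  refine ⟨_, fun Q huQ hQM => ?_, isOpen_setOf_notMem u, P.2.1.notMem_of_sup_eq_top hu hp⟩
  exact hM.1.notMem_of_sup_eq_top hv hm
    (hQM ((Q.2.2 u v (huv ▸ Q.1.top_mem)).resolve_left huQ))

theorem iInter_isPrime_subset_iff_of_isClosed
    (h : ∀ M : OpFilter op, M.IsMaximal → IsClosed {P : PrimeSpec op | P.1 ≤ M})
    (M : OpFilter op) (hM : M.IsMaximal) (N : OpFilter op) (hN : N.IsMaximal) :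
    (⋂ P ∈ {P : OpFilter op | P.IsPrime ∧ P ≤ M}, (P : Set X)) ⊆ (N : Set X) ↔ N = M := by
  constructor
  · intro hsub
    obtain ⟨F, hF⟩ := isClosed_iff.1 (h M hM)
    -- The filter `F` defining the closed set lies in every prime below `M`, hence in their
    -- intersection.
    have hFN : F ≤ N := fun a ha => hsub (Set.mem_iInter₂.2 fun P hP =>
      (Set.ext_iff.1 hF ⟨P, hP.1⟩).1 hP.2 ha)
    exact hN.eq_of_le hM ((Set.ext_iff.1 hF ⟨N, hN.isPrime⟩).2 hFN)
  · rintro rfl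
    exact Set.biInter_subset_of_mem (show N ∈ {P : OpFilter op | P.IsPrime ∧ P ≤ N} from
      ⟨hM.isPrime, le_rfl⟩)

/-- The characterizations of normality of the lattice of filters, for the filters with respect to
any operation that distributes over joins. -/
theorem isNormalLattice_tfae (op : X → X → X) [IsFilterOp op] :
    List.TFAE [
      IsNormalLattice (OpFilter op),
      IsNormalLattice (principalSublattice op),
      ∀ P : OpFilter op, P.IsPrime → ∃! M : OpFilter op, M.IsMaximal ∧ P ≤ M,
      ∃ r : PrimeSpec op → MaxSpec op, Continuous r ∧ ∀ M : MaxSpec op, r M.incl = M,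
      NormalSpace (PrimeSpec op),
      ∀ M : OpFilter op, M.IsMaximal → IsClosed {P : PrimeSpec op | P.1 ≤ M},
      ∀ M : OpFilter op, M.IsMaximal → ∀ N : OpFilter op, N.IsMaximal →
        ((⋂ P ∈ {P : OpFilter op | P.IsPrime ∧ P ≤ M}, (P : Set X)) ⊆ (N : Set X) ↔ N = M),
      ∀ M N : MaxSpec op, M ≠ N → ∃ U V : Set (PrimeSpec op),
        IsOpen U ∧ IsOpen V ∧ M.incl ∈ U ∧ N.incl ∈ V ∧ Disjoint U V] := by
  tfae_have 1 ↔ 2 := isNormalLattice_iff_principalSublattice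
  tfae_have 2 → 8 := separated_of_isNormalLattice
  tfae_have 8 → 3 := existsUnique_isMaximal_of_separated
  tfae_have 3 → 2 := isNormalLattice_of_existsUnique
  tfae_have 1 → 5 := normalSpace_of_isNormalLattice
  tfae_have 5 → 8 := separated_of_normalSpace
  tfae_have 3 → 4 := fun h => exists_retraction (isNormalLattice_of_existsUnique h) h
  tfae_have 4 → 3 := existsUnique_isMaximal_of_retraction
  tfae_have 2 → 6 := isClosed_setOf_le
  tfae_have 6 → 7 := iInter_isPrime_subset_iff_of_isClosed
  tfae_have 7 → 3 := existsUnique_isMaximal_of_iInter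
  tfae_finish

end Generic

/-! ### Principal filters of a distributive lattice and conormality. -/

theorem mem_principal_inf_iff {L : Type*} [DistribLattice L] [BoundedOrder L] {a b : L} :
    b ∈ principal (fun a b : L => a ⊓ b) a ↔ a ≤ b := by
  constructor
  · intro h
    let H : LatFilt L :=
      { carrier := Set.Ici a
        nonempty' := ⟨a, le_rfl⟩
        op_mem' := fun h₁ h₂ => le_inf h₁ h₂
        mem_of_le' := fun h₁ h₂ => le_trans h₁ h₂ }
    exact (principal_le.2 (le_refl a) : principal (fun a b : L => a ⊓ b) a ≤ H) h
  · exact fun h => mem_of_le _ (mem_principal_self a) h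

theorem isNormalLattice_principalSublattice_inf_iff {L : Type*} [DistribLattice L]
    [BoundedOrder L] :
    IsNormalLattice (principalSublattice (fun a b : L => a ⊓ b)) ↔ IsConormalLattice L := by
  simp only [isNormalLattice_principalSublattice_iff, principal_sup_principal, eq_top_iff_bot_mem,
    mem_principal_inf_iff, le_bot_iff, IsConormalLattice]

end OpFilter

/-! ### Transfer along the reticulation. -/

namespace IsReticulation

variable {A L : Type*} [ResiduatedLattice A] [DistribLattice L] [BoundedOrder L] {lam : A → L}

theorem eq_top_iff (h : IsReticulation lam) {a : A} : lam a = ⊤ ↔ a = ⊤ := by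
  refine ⟨fun ha => ?_, fun ha => ha ▸ h.map_top⟩
  obtain ⟨n, -, hn⟩ := (h.le_iff ⊤ a).1 (h.map_top.trans ha.symm).le
  rw [← ResiduatedLattice.one_eq_top, one_pow, ResiduatedLattice.one_eq_top] at hn
  exact top_unique hn

/-- Both sides say that some positive power of `a * b` is `⊥`. -/
theorem principal_sup_principal_eq_top_iff (h : IsReticulation lam) {a b : A} :
    OpFilter.principal (fun a b : A => a * b) a ⊔ OpFilter.principal (fun a b : A => a * b) b = ⊤ ↔
      lam a ⊓ lam b = ⊥ := by
  rw [OpFilter.principal_sup_principal, OpFilter.eq_top_iff_bot_mem,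
    ResiduatedLattice.mem_principal_iff, ← h.le_iff, h.map_bot, le_bot_iff, h.map_mul]

theorem isNormalLattice_pfilt_iff (h : IsReticulation lam) :
    IsNormalLattice (PFilt A) ↔ IsConormalLattice L := by
  simp only [OpFilter.isNormalLattice_principalSublattice_iff,
    h.principal_sup_principal_eq_top_iff, ← h.eq_top_iff, h.map_sup, IsConormalLattice,
    h.surjective.forall, h.surjective.exists]

end IsReticulation

theorem mainTheorem4 {A L : Type*} [ResiduatedLattice A] [DistribLattice L] [BoundedOrder L]
    (lam : A → L) (hlam : IsReticulation lam) :
    List.TFAE [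
      IsNormalLattice (Filt A),
      IsNormalLattice (PFilt A),
      IsConormalLattice L,
      ∀ P : Filt A, P.IsPrime → ∃! M : Filt A, M.IsMaximal ∧ P ≤ M,
      ∀ P : LatFilt L, P.IsPrime → ∃! M : LatFilt L, M.IsMaximal ∧ P ≤ M,
      ∃ r : ResSpec A → ResMax A, Continuous r ∧ ∀ M : ResMax A, r M.incl = M,
      ∃ r : LatSpec L → LatMax L, Continuous r ∧ ∀ M : LatMax L, r M.incl = M,
      NormalSpace (ResSpec A),
      NormalSpace (LatSpec L),
      ∀ M : Filt A, M.IsMaximal → IsClosed {P : ResSpec A | P.1 ≤ M},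
      ∀ M : LatFilt L, M.IsMaximal → IsClosed {P : LatSpec L | P.1 ≤ M},
      ∀ M : Filt A, M.IsMaximal → ∀ N : Filt A, N.IsMaximal →
        ((⋂ P ∈ {P : Filt A | P.IsPrime ∧ P ≤ M}, (P : Set A)) ⊆ (N : Set A) ↔ N = M),
      ∀ M : LatFilt L, M.IsMaximal → ∀ N : LatFilt L, N.IsMaximal →
        ((⋂ P ∈ {P : LatFilt L | P.IsPrime ∧ P ≤ M}, (P : Set L)) ⊆ (N : Set L) ↔ N = M),
      ∀ M N : ResMax A, M ≠ N → ∃ U V : Set (ResSpec A),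
        IsOpen U ∧ IsOpen V ∧ M.incl ∈ U ∧ N.incl ∈ V ∧ Disjoint U V,
      ∀ M N : LatMax L, M ≠ N → ∃ U V : Set (LatSpec L),
        IsOpen U ∧ IsOpen V ∧ M.incl ∈ U ∧ N.incl ∈ V ∧ Disjoint U V] := by
  have hA := OpFilter.isNormalLattice_tfae (fun a b : A => a * b)
  have hL := OpFilter.isNormalLattice_tfae (fun a b : L => a ⊓ b)
  tfae_have 2 ↔ 3 := hlam.isNormalLattice_pfilt_iff
  -- `out` counts the list entries from 0, `tfae_have` from 1.
  tfae_have 1 ↔ 2 := hA.out 0 1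
  tfae_have 2 ↔ 4 := hA.out 1 2
  tfae_have 2 ↔ 6 := hA.out 1 3
  tfae_have 2 ↔ 8 := hA.out 1 4
  tfae_have 2 ↔ 10 := hA.out 1 5
  tfae_have 2 ↔ 12 := hA.out 1 6
  tfae_have 2 ↔ 14 := hA.out 1 7
  have hC := OpFilter.isNormalLattice_principalSublattice_inf_iff (L := L)
  tfae_have 3 ↔ 5 := hC.symm.trans (hL.out 1 2)
  tfae_have 3 ↔ 7 := hC.symm.trans (hL.out 1 3)
  tfae_have 3 ↔ 9 := hC.symm.trans (hL.out 1 4)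
  tfae_have 3 ↔ 11 := hC.symm.trans (hL.out 1 5)
  tfae_have 3 ↔ 13 := hC.symm.trans (hL.out 1 6)
  tfae_have 3 ↔ 15 := hC.symm.trans (hL.out 1 7)
  tfae_finish
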